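/- Let $A$ be an (Archimedean) real vector lattice. Write $x\perp y$ if $|x|\wedge|y|=0$, and call $e\ge 0$ a component of $a\ge 0$ if $e\wedge(a-e)=0$. A linear operator $T:A\to A$ is band preserving if $x\perp y$ implies $T(x)\perp y$, and order bounded if it maps order bounded sets to order bounded sets; $A$ is a Wickstead space if every band preserving linear operator on $A$ is order bounded. $A$ is a Freudenthal (or hyper-Archimedean) vector lattice if, whenever $0\le x\le e$ in $A$, there are finitely many positive real numbers $\alpha_1,\dots,\alpha_n$ and components $e_1,\dots,e_n$ of $e$ with $x=\sum_{i=1}^n\alpha_i e_i$ (the empty sum being allowed). $A$ is locally one-dimensional if any two non-disjoint positive elements $x,y\in A$ have nonzero components $u$ of $x$ and $v$ of $y$ that are proportional, i.e. $u=\lambda v$ for some $\lambda\in\mathbb{R}$. Then: 1. if $A$ is a Freudenthal vector lattice, then $A$ is a Wickstead space; 2. if $A$ is locally one-dimensional, then $A$ is a Wickstead space. -/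

import Mathlib

namespace VectorLattice

/-- Disjointness `x ⊥ y` of two elements of a vector lattice. -/
def Perp {A : Type*} [AddCommGroup A] [Lattice A] (x y : A) : Prop :=
  |x| ⊓ |y| = 0

/-- `e` is a component of `a`; the second condition forces `0 ≤ e ≤ a`, hence `0 ≤ a`. -/
def IsComponent {A : Type*} [AddCommGroup A] [Lattice A] (e a : A) : Prop :=
  0 ≤ e ∧ e ⊓ (a - e) = 0

/-- Freudenthal (hyper-Archimedean) vector lattices: whenever `0 ≤ x ≤ e`, the element `x` is a
finite linear combination, with positive coefficients, of components of `e`. -/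
def IsFreudenthal (A : Type*) [AddCommGroup A] [Lattice A] [Module ℝ A] : Prop :=
  ∀ x e : A, 0 ≤ x → x ≤ e →
    ∃ (n : ℕ) (α : Fin n → ℝ) (c : Fin n → A),
      (∀ i, 0 < α i) ∧ (∀ i, IsComponent (c i) e) ∧ x = ∑ i, α i • c i

/-- Locally one-dimensional vector lattices: any two positive elements that are not disjoint have
nonzero components that are proportional to each other. -/
def IsLocallyOneDimensional (A : Type*) [AddCommGroup A] [Lattice A] [Module ℝ A] : Prop :=
  ∀ x y : A, 0 ≤ x → 0 ≤ y → ¬ Perp x y →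
    ∃ u v : A, IsComponent u x ∧ IsComponent v y ∧ u ≠ 0 ∧ v ≠ 0 ∧ ∃ r : ℝ, u = r • v

/-- A linear operator is band preserving if `x ⊥ y` implies `T x ⊥ y`. -/
def IsBandPreserving {A : Type*} [AddCommGroup A] [Lattice A] [Module ℝ A]
    (T : A →ₗ[ℝ] A) : Prop :=
  ∀ x y : A, Perp x y → Perp (T x) y

/-- A linear operator is order bounded if it maps order bounded sets to order bounded sets. -/
def IsOrderBounded {A : Type*} [AddCommGroup A] [Lattice A] [Module ℝ A]
    (T : A →ₗ[ℝ] A) : Prop :=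
  ∀ s : Set A, BddBelow s ∧ BddAbove s → BddBelow (T '' s) ∧ BddAbove (T '' s)

/-- A Wickstead space: every band preserving linear operator is order bounded. -/
def IsWickstead (A : Type*) [AddCommGroup A] [Lattice A] [Module ℝ A] : Prop :=
  ∀ T : A →ₗ[ℝ] A, IsBandPreserving T → IsOrderBounded T

end VectorLattice

set_option linter.unusedSectionVars false

namespace VectorLattice

section Group

variable {A : Type*} [AddCommGroup A] [Lattice A] [IsOrderedAddMonoid A]

/-! Both parts rest on the bound `|T x| ≤ |T e|` for `0 ≤ x ≤ e`, which suffices by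
`isOrderBounded_of_abs_map_le`. A band preserving `T` sends disjoint elements to disjoint ones, so
`|T c| + |T (e - c)| ≤ |T e|` for a component `c` of `e`. In the Freudenthal case, splitting `e`
along components reduces the bound to multiples of a single element (`abs_map_le_of_sum`). In the
locally one-dimensional case, a nonzero excess of `|T x|` over `|T e|` would be disjoint from a
nonzero component of `x` that it must meet. -/

theorem inf_add_le_inf_add_inf {a b c : A} (ha : 0 ≤ a) (hb : 0 ≤ b) (hc : 0 ≤ c) :
    a ⊓ (b + c) ≤ a ⊓ b + a ⊓ c := by
  rw [add_inf, inf_add, inf_add]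
  refine le_inf (le_inf ?_ ?_) (le_inf ?_ inf_le_right)
  · exact inf_le_left.trans (le_add_of_nonneg_left ha)
  · exact inf_le_left.trans (le_add_of_nonneg_left hb)
  · exact inf_le_left.trans (le_add_of_nonneg_right hc)

theorem inf_add_eq_zero {a b c : A} (ha : 0 ≤ a) (hb : 0 ≤ b) (hc : 0 ≤ c)
    (hab : a ⊓ b = 0) (hac : a ⊓ c = 0) : a ⊓ (b + c) = 0 := by
  refine le_antisymm ?_ (le_inf ha (add_nonneg hb hc))
  simpa [hab, hac] using inf_add_le_inf_add_inf ha hb hc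

theorem inf_eq_zero_of_le {a a' b b' : A} (ha : 0 ≤ a) (hb : 0 ≤ b) (haa : a ≤ a') (hbb : b ≤ b')
    (h : a' ⊓ b' = 0) : a ⊓ b = 0 :=
  le_antisymm ((inf_le_inf haa hbb).trans h.le) (le_inf ha hb)

theorem le_of_le_add_of_inf_eq_zero {a b c : A} (ha : 0 ≤ a) (hb : 0 ≤ b) (hc : 0 ≤ c)
    (h : a ≤ b + c) (hac : a ⊓ c = 0) : a ≤ b := by
  have h1 := inf_add_le_inf_add_inf ha hb hc
  rw [inf_eq_left.2 h, hac, add_zero] at h1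
  exact h1.trans inf_le_right

theorem Perp.symm {x y : A} (h : Perp x y) : Perp y x := by
  unfold Perp at *
  rwa [inf_comm]

theorem perp_of_inf_eq_zero {x y : A} (hx : 0 ≤ x) (hy : 0 ≤ y) (h : x ⊓ y = 0) : Perp x y := by
  rwa [Perp, abs_of_nonneg hx, abs_of_nonneg hy]

theorem Perp.add_left {x y z : A} (hx : Perp x z) (hy : Perp y z) : Perp (x + y) z := by
  have h := inf_add_eq_zero (abs_nonneg z) (abs_nonneg x) (abs_nonneg y) hx.symm hy.symm
  rw [inf_comm] at h
  exact inf_eq_zero_of_le (abs_nonneg _) (abs_nonneg _) (abs_add_le x y) le_rfl h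

/-- In `|x| ≤ |x + y| + |y|` the last term can be dropped, being disjoint from `|x|`. -/
theorem Perp.abs_left_le {x y : A} (h : Perp x y) : |x| ≤ |x + y| := by
  refine le_of_le_add_of_inf_eq_zero (abs_nonneg x) (abs_nonneg _) (abs_nonneg y) ?_ h
  simpa using abs_add_le (x + y) (-y)

theorem Perp.abs_add_abs_le {x y : A} (h : Perp x y) : |x| + |y| ≤ |x + y| := by
  have hy := h.symm.abs_left_le
  rw [add_comm y x] at hy
  rw [← inf_add_sup, show |x| ⊓ |y| = 0 from h, zero_add]
  exact sup_le h.abs_left_le hy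

theorem IsComponent.le {c e : A} (h : IsComponent c e) : c ≤ e :=
  sub_nonneg.1 (h.2.ge.trans inf_le_right)

theorem IsComponent.compl {c e : A} (h : IsComponent c e) : IsComponent (e - c) e :=
  ⟨sub_nonneg.2 h.le, by rw [sub_sub_cancel, inf_comm]; exact h.2⟩

theorem IsComponent.perp {c e : A} (h : IsComponent c e) : Perp c (e - c) :=
  perp_of_inf_eq_zero h.1 h.compl.1 h.2

theorem IsComponent.trans {d c e : A} (h : IsComponent d c) (h' : IsComponent c e) :
    IsComponent d e := by
  refine ⟨h.1, ?_⟩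
  rw [← sub_add_sub_cancel e c d]
  exact inf_add_eq_zero h.1 h'.compl.1 h.compl.1
    (inf_eq_zero_of_le h.1 h'.compl.1 h.le le_rfl h'.2) h.2

theorem IsComponent.eq_inf_add_inf {d c e : A} (hd : IsComponent d e) (hc : IsComponent c e) :
    d = d ⊓ c + d ⊓ (e - c) := by
  apply le_antisymm
  · have h := inf_add_le_inf_add_inf hd.1 hc.1 hc.compl.1
    rwa [add_sub_cancel, inf_eq_left.2 hd.le] at h
  · rw [← inf_add_sup, inf_eq_zero_of_le (le_inf hd.1 hc.1) (le_inf hd.1 hc.compl.1)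
      inf_le_right inf_le_right hc.2, zero_add]
    exact sup_le inf_le_left inf_le_left

theorem IsComponent.inf {d c e : A} (hd : IsComponent d e) (hc : IsComponent c e) :
    IsComponent (d ⊓ c) c := by
  refine ⟨le_inf hd.1 hc.1, ?_⟩
  refine inf_eq_zero_of_le (le_inf hd.1 hc.1) (sub_nonneg.2 inf_le_right) inf_le_left ?_ hd.2
  have h : e - d = (c - d ⊓ c) + (e - c - d ⊓ (e - c)) := by
    conv_lhs => rw [hd.eq_inf_add_inf hc]
    abel
  rw [h]
  exact le_add_of_nonneg_right (sub_nonneg.2 inf_le_right)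

end Group

section Module

variable {A : Type*} [AddCommGroup A] [Lattice A] [IsOrderedAddMonoid A]
  [Module ℝ A] [PosSMulMono ℝ A]

theorem smul_le_abs_smul_abs (r : ℝ) (x : A) : r • x ≤ |r| • |x| := by
  rcases le_total 0 r with hr | hr
  · rw [abs_of_nonneg hr]
    exact smul_le_smul_of_nonneg_left (le_abs_self x) hr
  · rw [abs_of_nonpos hr, ← neg_smul_neg]
    exact smul_le_smul_of_nonneg_left (neg_le_abs x) (neg_nonneg.2 hr)

theorem abs_smul_le (r : ℝ) (x : A) : |r • x| ≤ |r| • |x| := by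
  refine abs_le'.2 ⟨smul_le_abs_smul_abs r x, ?_⟩
  rw [← neg_smul, ← abs_neg r]
  exact smul_le_abs_smul_abs (-r) x

theorem smul_le_smul_right_of_nonneg {r s : ℝ} {x : A} (h : r ≤ s) (hx : 0 ≤ x) :
    r • x ≤ s • x := by
  rw [← sub_nonneg, ← sub_smul]
  exact smul_nonneg (sub_nonneg.2 h) hx

theorem le_one_of_smul_le_self {r : ℝ} {x : A} (hx : 0 ≤ x) (hx0 : x ≠ 0) (h : r • x ≤ x) :
    r ≤ 1 := by
  by_contra! hr
  have hr' : 0 < r - 1 := sub_pos.2 hr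
  have h1 : (r - 1) • x ≤ 0 := by
    rw [sub_smul, one_smul]
    exact sub_nonpos.2 h
  have h2 := smul_le_smul_of_nonneg_left h1 (inv_pos.2 hr').le
  rw [inv_smul_smul₀ hr'.ne', smul_zero] at h2
  exact hx0 (le_antisymm h2 hx)

theorem pos_of_eq_smul {r : ℝ} {u v : A} (hu : 0 ≤ u) (hv : 0 ≤ v) (hu0 : u ≠ 0)
    (h : u = r • v) : 0 < r := by
  by_contra! hr
  refine hu0 (le_antisymm ?_ hu)
  rw [h]
  simpa using smul_le_smul_right_of_nonneg hr hv

theorem Perp.smul_left {x y : A} (h : Perp x y) (r : ℝ) : Perp (r • x) y := by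
  -- An integer bound on the scalar reduces the claim to stability of disjointness under sums.
  obtain ⟨n, hn⟩ := exists_nat_ge |r|
  have key : ∀ n : ℕ, |y| ⊓ (n • |x|) = 0 := by
    intro n
    induction n with
    | zero => simp
    | succ n ih =>
      rw [succ_nsmul]
      exact inf_add_eq_zero (abs_nonneg y) (nsmul_nonneg (abs_nonneg x) n) (abs_nonneg x) ih h.symm
  refine Perp.symm (inf_eq_zero_of_le (abs_nonneg y) (abs_nonneg _) le_rfl ?_ (key n))
  rw [← Nat.cast_smul_eq_nsmul ℝ]
  exact (abs_smul_le r x).trans (smul_le_smul_right_of_nonneg hn (abs_nonneg x))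

theorem perp_sum_smul {ι : Type*} {s : Finset ι} {α : ι → ℝ} {c : ι → A} {y : A}
    (h : ∀ i ∈ s, Perp (c i) y) : Perp (∑ i ∈ s, α i • c i) y := by
  refine Finset.sum_induction _ (fun x => Perp x y) (fun _ _ => Perp.add_left) ?_
    fun i hi => (h i hi).smul_left _
  simp [Perp]

theorem IsBandPreserving.perp_map {T : A →ₗ[ℝ] A} (hT : IsBandPreserving T) {x y : A}
    (h : Perp x y) : Perp (T x) (T y) :=
  (hT _ _ (hT _ _ h).symm).symm

theorem IsBandPreserving.abs_add_abs_le {T : A →ₗ[ℝ] A} (hT : IsBandPreserving T) {c e : A}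
    (h : IsComponent c e) : |T c| + |T (e - c)| ≤ |T e| := by
  have := (hT.perp_map h.perp).abs_add_abs_le
  rwa [← map_add, add_sub_cancel] at this

/-- Translation by a lower bound `a` moves the set into `[0, b - a]`. -/
theorem isOrderBounded_of_abs_map_le {T : A →ₗ[ℝ] A}
    (h : ∀ x e : A, 0 ≤ x → x ≤ e → |T x| ≤ |T e|) : IsOrderBounded T := by
  rintro s ⟨⟨a, ha⟩, ⟨b, hb⟩⟩
  have key : ∀ x ∈ s, |T x - T a| ≤ |T (b - a)| := by
    intro x hx
    rw [← map_sub]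
    exact h _ _ (sub_nonneg.2 (ha hx)) (sub_le_sub_right (hb hx) a)
  constructor
  · refine ⟨T a - |T (b - a)|, ?_⟩
    rintro _ ⟨x, hx, rfl⟩
    rw [sub_le_comm]
    refine le_trans ?_ (key x hx)
    rw [← neg_sub (T x)]
    exact neg_le_abs _
  · refine ⟨|T (b - a)| + T a, ?_⟩
    rintro _ ⟨x, hx, rfl⟩
    rw [← sub_le_iff_le_add]
    exact (le_abs_self _).trans (key x hx)

theorem abs_map_smul_le_of_abs_smul_le {T : A →ₗ[ℝ] A} {e : A} (he : 0 ≤ e) {β : ℝ}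
    (h : |β • e| ≤ e) : |T (β • e)| ≤ |T e| := by
  rcases eq_or_ne e 0 with rfl | he0
  · simp
  have hβ : |β| ≤ 1 := abs_le'.2
    ⟨le_one_of_smul_le_self he he0 ((le_abs_self _).trans h),
      le_one_of_smul_le_self he he0 (by rw [neg_smul]; exact (neg_le_abs _).trans h)⟩
  rw [map_smul]
  refine (abs_smul_le _ _).trans ?_
  simpa using smul_le_smul_right_of_nonneg hβ (abs_nonneg (T e))

/-- A band preserving operator does not increase `|T e|` on linear combinations of components of
`e` dominated by `e`. The term `β • e` makes the induction on the number of components work. -/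
theorem IsBandPreserving.abs_map_le_of_sum {T : A →ₗ[ℝ] A} (hT : IsBandPreserving T) (n : ℕ) :
    ∀ (e : A) (β : ℝ) (α : Fin n → ℝ) (c : Fin n → A), 0 ≤ e → (∀ i, IsComponent (c i) e) →
      |β • e + ∑ i, α i • c i| ≤ e → |T (β • e + ∑ i, α i • c i)| ≤ |T e| := by
  induction n with
  | zero =>
    intro e β α c he _ h
    simp only [Finset.univ_eq_empty, Finset.sum_empty, add_zero] at h ⊢
    exact abs_map_smul_le_of_abs_smul_le he h
  | succ n ih =>
    intro e β α c he hc h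
    set d := c 0
    have hd : IsComponent d e := hc 0
    -- Over `d` the component `c 0` is everything, so its coefficient joins `β`; over `e - d` it
    -- vanishes. Either way one component fewer remains.
    set x₁ : A := (β + α 0) • d + ∑ i : Fin n, α i.succ • (c i.succ ⊓ d) with hx₁
    set x₂ : A := β • (e - d) + ∑ i : Fin n, α i.succ • (c i.succ ⊓ (e - d)) with hx₂
    have hx : β • e + ∑ i, α i • c i = x₁ + x₂ := by
      have hs : ∑ i : Fin n, α i.succ • c i.succ = ∑ i : Fin n, α i.succ • (c i.succ ⊓ d) +
          ∑ i : Fin n, α i.succ • (c i.succ ⊓ (e - d)) := by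
        rw [← Finset.sum_add_distrib]
        refine Finset.sum_congr rfl fun i _ => ?_
        rw [← smul_add, ← (hc i.succ).eq_inf_add_inf hd]
      rw [Fin.sum_univ_succ, hs, hx₁, hx₂, add_smul, smul_sub]
      abel
    have perp_part : ∀ f g : A, IsComponent f e → 0 ≤ g → f ⊓ g = 0 → ∀ γ : ℝ,
        Perp (γ • f + ∑ i : Fin n, α i.succ • (c i.succ ⊓ f)) g := by
      intro f g hf hg hfg γ
      refine ((perp_of_inf_eq_zero hf.1 hg hfg).smul_left γ).add_left (perp_sum_smul fun i _ => ?_)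
      have h0 : 0 ≤ c i.succ ⊓ f := le_inf (hc _).1 hf.1
      exact perp_of_inf_eq_zero h0 hg (inf_eq_zero_of_le h0 hg inf_le_right le_rfl hfg)
    have p₁ : Perp x₁ (e - d) := perp_part d (e - d) hd hd.compl.1 hd.2 _
    have p₂ : Perp x₂ d := perp_part (e - d) d hd.compl hd.1 (by rw [inf_comm]; exact hd.2) _
    have p : Perp x₁ x₂ := by
      refine Perp.symm ?_
      refine (Perp.smul_left p₁.symm β).add_left (perp_sum_smul fun i _ => ?_)
      have h0 : 0 ≤ c i.succ ⊓ (e - d) := le_inf (hc _).1 hd.compl.1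
      refine inf_eq_zero_of_le (abs_nonneg _) (abs_nonneg _) ?_ le_rfl p₁.symm
      rw [abs_of_nonneg h0, abs_of_nonneg hd.compl.1]
      exact inf_le_right
    rw [hx] at h ⊢
    have b₁ : |x₁| ≤ d := by
      refine le_of_le_add_of_inf_eq_zero (abs_nonneg _) hd.1 hd.compl.1 ?_
        (by simpa [Perp, abs_of_nonneg hd.compl.1] using p₁)
      rw [add_sub_cancel]
      exact p.abs_left_le.trans h
    have b₂ : |x₂| ≤ e - d := by
      refine le_of_le_add_of_inf_eq_zero (abs_nonneg _) hd.compl.1 hd.1 ?_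
        (by simpa [Perp, abs_of_nonneg hd.1] using p₂)
      rw [sub_add_cancel]
      rw [add_comm] at h
      exact p.symm.abs_left_le.trans h
    rw [map_add]
    refine (abs_add_le _ _).trans ((add_le_add ?_ ?_).trans (hT.abs_add_abs_le hd))
    · exact ih d _ _ _ hd.1 (fun i => (hc i.succ).inf hd) b₁
    · exact ih (e - d) _ _ _ hd.compl.1 (fun i => (hc i.succ).inf hd.compl) b₂

theorem IsFreudenthal.isWickstead (hA : IsFreudenthal A) : IsWickstead A := by
  refine fun T hT => isOrderBounded_of_abs_map_le fun x e hx hxe => ?_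
  obtain ⟨n, α, c, -, hc, rfl⟩ := hA x e hx hxe
  have h := hT.abs_map_le_of_sum n e 0 α c (hx.trans hxe) hc
  rw [zero_smul, zero_add] at h
  exact h (by rwa [abs_of_nonneg hx])

/-- If proportional components `u` of `x` and `v` of `e` are given and `0 ≤ x ≤ e`, then
`|T x|` exceeds `|T e|` only off `u`. -/
theorem IsBandPreserving.abs_map_le_add_of_eq_smul {T : A →ₗ[ℝ] A} (hT : IsBandPreserving T)
    {x e u v : A} {r : ℝ} (hxe : x ≤ e) (hu : IsComponent u x) (hv : IsComponent v e)
    (hu0 : u ≠ 0) (hv0 : v ≠ 0) (h : u = r • v) : |T x| ≤ |T (x - u)| + |T e| := by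
  have hr : 0 < r := pos_of_eq_smul hu.1 hv.1 hu0 h
  have huv : u ⊓ (e - v) = 0 := by
    have := hv.perp.smul_left r
    rwa [← h, Perp, abs_of_nonneg hu.1, abs_of_nonneg hv.compl.1] at this
  have hle : u ≤ v := le_of_le_add_of_inf_eq_zero hu.1 hv.1 hv.compl.1
    (by rw [add_sub_cancel]; exact hu.le.trans hxe) huv
  have hr1 : r ≤ 1 := le_one_of_smul_le_self hv.1 hv0 (h ▸ hle)
  have hTu : |T u| ≤ |T e| := by
    calc |T u| ≤ |r| • |T v| := by rw [h, map_smul]; exact abs_smul_le _ _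
      _ ≤ |T v| := by
        rw [abs_of_pos hr]
        simpa using smul_le_smul_right_of_nonneg hr1 (abs_nonneg (T v))
      _ ≤ |T e| := (le_add_of_nonneg_right (abs_nonneg _)).trans (hT.abs_add_abs_le hv)
  calc |T x| = |T (x - u) + T u| := by rw [← map_add, sub_add_cancel]
    _ ≤ |T (x - u)| + |T u| := abs_add_le _ _
    _ ≤ |T (x - u)| + |T e| := by gcongr

theorem IsLocallyOneDimensional.isWickstead (hA : IsLocallyOneDimensional A) : IsWickstead A := by
  refine fun T hT => isOrderBounded_of_abs_map_le fun x e hx hxe => ?_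
  set w : A := (|T x| - |T e|) ⊔ 0
  have hw0 : 0 ≤ w := le_sup_right
  suffices hwz : w = 0 from sub_nonpos.1 (le_sup_left.trans hwz.le)
  by_contra hwne
  have hwT : w ≤ |T x| := sup_le (sub_le_self _ (abs_nonneg _)) (abs_nonneg _)
  have hxw0 : 0 ≤ x ⊓ w := le_inf hx hw0
  -- Otherwise `T x ⊥ w`, although `0 ≠ w ≤ |T x|`.
  have hxw : x ⊓ w ≠ 0 := by
    intro h0
    have h1 := hT x w (perp_of_inf_eq_zero hx hw0 h0)
    rw [Perp, abs_of_nonneg hw0, inf_eq_right.2 hwT] at h1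
    exact hwne h1
  obtain ⟨u, u₁, hu, hu₁, hu0, -, r, hr⟩ := hA x (x ⊓ w) hx hxw0 (by
    rwa [Perp, abs_of_nonneg hx, abs_of_nonneg hxw0, inf_eq_right.2 inf_le_left])
  -- The second choice is made inside `u`, so that `u'` lies below a multiple of `w` and is also
  -- proportional to a component of `e`.
  obtain ⟨u', v, hu', hv, hu'0, hv0, s, hs⟩ := hA u e hu.1 (hx.trans hxe) (by
    rwa [Perp, abs_of_nonneg hu.1, abs_of_nonneg (hx.trans hxe),
      inf_eq_left.2 (hu.le.trans hxe)])
  have hu'x : IsComponent u' x := hu'.trans hu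
  have hle : w ≤ |T (x - u')| :=
    sup_le (sub_le_iff_le_add.2 (hT.abs_map_le_add_of_eq_smul hxe hu'x hv hu'0 hv0 hs))
      (abs_nonneg _)
  -- `x - u' ⊥ u'` gives `T (x - u') ⊥ u'`, and `w` lies below `|T (x - u')|`.
  have hperp : Perp w u' := by
    refine inf_eq_zero_of_le (abs_nonneg _) (abs_nonneg _) ?_ le_rfl (hT _ _ hu'x.perp.symm)
    rwa [abs_of_nonneg hw0]
  have hperp₁ : Perp u₁ u' := by
    refine inf_eq_zero_of_le (abs_nonneg _) (abs_nonneg _) ?_ le_rfl hperp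
    rw [abs_of_nonneg hw0, abs_of_nonneg hu₁.1]
    exact hu₁.le.trans inf_le_right
  have hperp₂ := hperp₁.smul_left r
  rw [← hr, Perp, abs_of_nonneg hu.1, abs_of_nonneg hu'.1, inf_eq_right.2 hu'.le] at hperp₂
  exact hu'0 hperp₂

end Module

end VectorLattice

theorem mainTheorem12 {A : Type*} [AddCommGroup A] [Lattice A] [IsOrderedAddMonoid A]
    [Module ℝ A] [PosSMulMono ℝ A] :
    (VectorLattice.IsFreudenthal A → VectorLattice.IsWickstead A) ∧
      (VectorLattice.IsLocallyOneDimensional A → VectorLattice.IsWickstead A) :=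
  ⟨VectorLattice.IsFreudenthal.isWickstead, VectorLattice.IsLocallyOneDimensional.isWickstead⟩
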